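/- For positive integers $i_1,\dots,i_k$ with $i_k\ge 2$, define the multiple mixed value \[ \mu(i_k,i_{k-1},\dots,i_1)=\sum_{\substack{n_k>n_{k-1}>\cdots>n_1\ge 1\\ n_j\equiv j\ (\mathrm{mod}\ 2)}}\frac{1}{n_k^{i_k}n_{k-1}^{i_{k-1}}\cdots n_1^{i_1}}, \] the sum being over integers $n_1,\dots,n_k$, and let $\{1\}^m$ denote the sequence $1,\dots,1$ of length $m$. Then for all integers $n,r\ge 0$ the series defining $\mu(r+2,\{1\}^n)$ and $\mu(n+2,\{1\}^r)$ converge, and \[ 2^{n}\,\mu(r+2,\{1\}^{n})=2^{r}\,\mu(n+2,\{1\}^{r}). \] -/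

import Mathlib

/-- The summation range of a multiple mixed value of depth `k`: tuples of positive integers
`n₁ < n₂ < ⋯ < n_k` with `n_j ≡ j (mod 2)`. The entry `n_j` of the mathematical notation is
`n ⟨j - 1, _⟩` here, since `Fin k` counts from `0`. -/
def mixedTuples (k : ℕ) : Set (Fin k → ℕ) :=
  {n | StrictMono n ∧ ∀ j : Fin k, 0 < n j ∧ n j ≡ (j : ℕ) + 1 [MOD 2]}

/-- The term `1 / (n_k ^ i_k ⋯ n₁ ^ i₁)` belonging to the multi-index
`s = [i_k, i_{k-1}, …, i₁]`, written with its leading entry `i_k` first. Hence the exponent of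
`n_j` is the entry of `s` at the reversed position. -/
noncomputable def mixedTerm (s : List ℕ) (n : mixedTuples s.length) : ℝ :=
  1 / ∏ j : Fin s.length, ((n : Fin s.length → ℕ) j : ℝ) ^ s.get j.rev

/-- The multiple mixed value `μ(i_k, i_{k-1}, …, i₁)`, for `s = [i_k, i_{k-1}, …, i₁]`. It is
meant for positive entries with leading entry at least `2`. -/
noncomputable def multipleMixedValue (s : List ℕ) : ℝ :=
  ∑' n : mixedTuples s.length, mixedTerm s n

open MeasureTheory Set Filter Topology

/-! Let `G_k(u) = ∑ exp(-n_k u) / (n₁ ⋯ n_k)` over mixed tuples (`mixedGenFun`) and `L(u) = log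
coth(u/2)`. Differentiating removes the factor `1/n_k`, and summing over the odd gap before `n_k`
gives `G_k' = -G_{k-1} / (2 sinh u)`. Since `L' = -1 / sinh u` and both `G_k` (for `k ≥ 1`) and `L`
vanish at infinity, `G_k = (L/2)^k / k!` (`mixedGenFun_eq`).

Gamma integrals then express each value in two ways: by integrating `G_k` (`tsum_eq_lintegral_pow`)
or `-G_k'` (`tsum_eq_lintegral_halfCsch`) against a power of `u`. As `L` is an involution of the
positive reals, substituting `u ↦ L(u)` exchanges the powers of `u` and `L` and carries the first
form of one side to the second form of the other; the halves in `(L/2)^k` account for the powers of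
`2`.

Identities are proved in `ENNReal`, where sums and integrals of nonnegative terms interchange
freely; summability is shown separately. -/

/-! ### Mixed tuples, built one entry at a time -/

/-- The largest entry of a tuple, with the convention that it is `0` for the empty tuple. -/
def lastEntry : {k : ℕ} → (Fin k → ℕ) → ℕ
  | 0, _ => 0
  | k + 1, n => n (Fin.last k)

theorem le_lastEntry {k : ℕ} {n : Fin k → ℕ} (hn : n ∈ mixedTuples k) (j : Fin k) :
    n j ≤ lastEntry n := by
  cases k with
  | zero => exact j.elim0
  | succ k => exact hn.1.monotone (Fin.le_last j)

theorem lastEntry_mod_two {k : ℕ} {n : Fin k → ℕ} (hn : n ∈ mixedTuples k) :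
    lastEntry n ≡ k [MOD 2] := by
  cases k with
  | zero => rfl
  | succ k => simpa [lastEntry] using (hn.2 (Fin.last k)).2

theorem snoc_mem_mixedTuples {k : ℕ} {n : Fin k → ℕ} (hn : n ∈ mixedTuples k) (m : ℕ) :
    (Fin.snoc n (lastEntry n + 1 + 2 * m) : Fin (k + 1) → ℕ) ∈ mixedTuples (k + 1) := by
  refine ⟨?_, ?_⟩
  · intro i j hij
    induction j using Fin.lastCases with
    | last =>
      induction i using Fin.lastCases with
      | last => exact absurd hij (lt_irrefl _)
      | cast i =>
        have := le_lastEntry hn i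
        simp only [Fin.snoc_castSucc, Fin.snoc_last]
        omega
    | cast j =>
      induction i using Fin.lastCases with
      | last => exact absurd hij (not_lt.2 (Fin.le_last _))
      | cast i =>
        simp only [Fin.snoc_castSucc]
        exact hn.1 (by simpa using hij)
  · intro j
    induction j using Fin.lastCases with
    | last =>
      have := lastEntry_mod_two hn
      simp only [Fin.snoc_last, Fin.val_last, Nat.ModEq] at *
      omega
    | cast j => simpa using hn.2 j

theorem init_mem_mixedTuples {k : ℕ} {n : Fin (k + 1) → ℕ} (hn : n ∈ mixedTuples (k + 1)) :
    (Fin.init n : Fin k → ℕ) ∈ mixedTuples k :=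
  ⟨fun _ _ hij => hn.1 (by simpa using hij), fun j => by simpa [Fin.init] using hn.2 j.castSucc⟩

theorem lastEntry_init_lt {k : ℕ} {n : Fin (k + 1) → ℕ} (hn : n ∈ mixedTuples (k + 1)) :
    lastEntry (Fin.init n : Fin k → ℕ) < n (Fin.last k) := by
  cases k with
  | zero => exact (hn.2 _).1
  | succ k => exact hn.1 (Fin.castSucc_lt_last _)

/-- A mixed tuple of length `k + 1` is a mixed tuple of length `k` together with the half gap
before its last entry. -/
def mixedTuplesSnoc (k : ℕ) : mixedTuples k × ℕ ≃ mixedTuples (k + 1) where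
  -- For `k = 0` the convention `lastEntry = 0` makes the new entry `1 + 2 m`, as parity requires of
  -- `n₁`.
  toFun p := ⟨Fin.snoc p.1.1 (lastEntry p.1.1 + 1 + 2 * p.2), snoc_mem_mixedTuples p.1.2 p.2⟩
  invFun n := (⟨Fin.init n.1, init_mem_mixedTuples n.2⟩,
    (n.1 (Fin.last k) - lastEntry (Fin.init n.1 : Fin k → ℕ) - 1) / 2)
  left_inv p := by
    ext
    · simp
    · simp only [Fin.snoc_last, Fin.init_snoc]
      omega
  right_inv n := by
    have h1 := lastEntry_mod_two (init_mem_mixedTuples n.2)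
    have h2 := lastEntry_init_lt n.2
    have h3 := lastEntry_mod_two n.2
    simp only [Nat.ModEq] at h1 h3
    rw [lastEntry] at h3
    ext j
    induction j using Fin.lastCases with
    | last =>
      simp only [Fin.snoc_last]
      omega
    | cast j => simp [Fin.init]

/-- The product of the reciprocals of the entries of a tuple. -/
noncomputable def invProd {k : ℕ} (n : Fin k → ℕ) : ℝ := ∏ j, (n j : ℝ)⁻¹

theorem invProd_nonneg {k : ℕ} (n : Fin k → ℕ) : 0 ≤ invProd n :=
  Finset.prod_nonneg fun _ _ => by positivity

@[simp] theorem lastEntry_mixedTuplesSnoc {k : ℕ} (p : mixedTuples k × ℕ) :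
    lastEntry (mixedTuplesSnoc k p).1 = lastEntry p.1.1 + 1 + 2 * p.2 := by
  simp [lastEntry, mixedTuplesSnoc]

theorem invProd_mixedTuplesSnoc {k : ℕ} (p : mixedTuples k × ℕ) :
    invProd (mixedTuplesSnoc k p).1 =
      invProd p.1.1 * ((lastEntry p.1.1 + 1 + 2 * p.2 : ℕ) : ℝ)⁻¹ := by
  simp [invProd, mixedTuplesSnoc, Fin.prod_univ_castSucc, mul_comm]

theorem lastEntry_pos {k : ℕ} (n : mixedTuples (k + 1)) : 0 < lastEntry n.1 :=
  (n.2.2 (Fin.last k)).1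

theorem mixedTerm_cons_ones {l : List ℕ} (hl : ∀ x ∈ l, x = 1) (a : ℕ)
    (n : mixedTuples (l.length + 1)) :
    mixedTerm ((a + 1) :: l) n = invProd n.1 * ((lastEntry n.1 : ℝ) ^ a)⁻¹ := by
  have h : ∏ j : Fin (l.length + 1), (n.1 j : ℝ) ^ ((a + 1) :: l).get j.rev =
      (∏ j, (n.1 j : ℝ)) * (lastEntry n.1 : ℝ) ^ a := by
    rw [Fin.prod_univ_castSucc, Fin.prod_univ_castSucc, lastEntry]
    have h1 : ∀ j : Fin l.length, ((a + 1) :: l).get j.castSucc.rev = 1 := fun j => by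
      rw [Fin.rev_castSucc]
      exact hl _ (List.get_mem _ _)
    have h2 : ((a + 1) :: l).get (Fin.last l.length).rev = a + 1 := by
      rw [Fin.rev_last]; rfl
    rw [h2]
    simp only [h1, pow_one]
    ring
  unfold mixedTerm
  refine (congrArg (fun x : ℝ => 1 / x) h).trans ?_
  simp [invProd, mul_comm]

/-! ### Convergence -/

/-- The appended entry is at least `m + 1`, with `m` the half gap, so each new entry costs at most a
convergent `p`-series. -/
theorem summable_prod_rpow_neg {p : ℝ} (hp : 1 < p) (k : ℕ) :
    Summable fun n : mixedTuples k => ∏ j, (n.1 j : ℝ) ^ (-p) := by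
  induction k with
  | zero =>
    have : Finite (mixedTuples 0) := inferInstance
    exact Summable.of_finite
  | succ k ih =>
    rw [← (mixedTuplesSnoc k).summable_iff]
    have h : Summable fun m : ℕ => ((m : ℝ) + 1) ^ (-p) := by
      have := (summable_nat_add_iff 1).2 (Real.summable_nat_rpow.2 (neg_lt_neg hp))
      simpa using this
    refine Summable.of_nonneg_of_le (fun _ => ?_) (fun q => ?_) (ih.mul_of_nonneg h ?_ ?_)
    · exact Finset.prod_nonneg fun _ _ => by positivity
    · simp only [Function.comp, mixedTuplesSnoc, Equiv.coe_fn_mk, Fin.prod_univ_castSucc,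
        Fin.snoc_castSucc, Fin.snoc_last]
      refine mul_le_mul_of_nonneg_left ?_ (Finset.prod_nonneg fun _ _ => by positivity)
      refine Real.rpow_le_rpow_of_nonpos (by positivity) ?_ (by linarith)
      push_cast
      have : (0 : ℝ) ≤ lastEntry q.1.1 := by positivity
      have : (0 : ℝ) ≤ q.2 := by positivity
      linarith
    · exact fun _ => Finset.prod_nonneg fun _ _ => by positivity
    · exact fun _ => by positivity

/-- One factor `1/n_{k+1}` is shared equally: it is at most `∏ n_j^(-1/(k+1))`, which raises every
exponent above `1`. -/
theorem summable_invProd_mul_lastEntry (k a : ℕ) :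
    Summable fun n : mixedTuples (k + 1) => invProd n.1 * ((lastEntry n.1 : ℝ) ^ (a + 1))⁻¹ := by
  set e : ℝ := 1 / ((k + 1 : ℕ) : ℝ) with he
  have hk : (0 : ℝ) < ((k + 1 : ℕ) : ℝ) := by positivity
  have he0 : 0 < e := by positivity
  refine Summable.of_nonneg_of_le (fun n => ?_) (fun n => ?_)
    (summable_prod_rpow_neg (p := 1 + e) (by linarith) (k + 1))
  · exact mul_nonneg (invProd_nonneg _) (by positivity)
  · have hL : (1 : ℝ) ≤ lastEntry n.1 := by exact_mod_cast lastEntry_pos n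
    have hL0 : (0 : ℝ) < lastEntry n.1 := by linarith
    have hj : ∀ j, (0 : ℝ) < n.1 j := fun j => by exact_mod_cast (n.2.2 j).1
    have h1 : ((lastEntry n.1 : ℝ) ^ (a + 1))⁻¹ ≤ ∏ j, (n.1 j : ℝ) ^ (-e) := by
      calc ((lastEntry n.1 : ℝ) ^ (a + 1))⁻¹ ≤ (lastEntry n.1 : ℝ)⁻¹ := by
            refine inv_anti₀ hL0 ?_
            exact le_self_pow₀ hL (by omega)
        _ = ∏ j : Fin (k + 1), (lastEntry n.1 : ℝ) ^ (-e) := by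
            rw [Finset.prod_const, Finset.card_univ, Fintype.card_fin, ← Real.rpow_natCast,
              ← Real.rpow_mul hL0.le, he, neg_mul, one_div, inv_mul_cancel₀ hk.ne', Real.rpow_neg_one]
        _ ≤ ∏ j, (n.1 j : ℝ) ^ (-e) := by
            refine Finset.prod_le_prod (fun _ _ => by positivity) fun j _ => ?_
            refine Real.rpow_le_rpow_of_nonpos (hj j) ?_ (by linarith)
            exact_mod_cast le_lastEntry n.2 j
    calc _ ≤ invProd n.1 * ∏ j, (n.1 j : ℝ) ^ (-e) :=
          mul_le_mul_of_nonneg_left h1 (invProd_nonneg _)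
      _ = _ := by
          rw [invProd, ← Finset.prod_mul_distrib]
          refine Finset.prod_congr rfl fun j _ => ?_
          rw [neg_add, Real.rpow_add (hj j), Real.rpow_neg_one]


/-! ### The involution and its kernel -/

/-- The involution `u ↦ log (coth (u / 2))` of the positive reals. -/
noncomputable def logCothHalf (u : ℝ) : ℝ :=
  Real.log ((1 + Real.exp (-u)) / (1 - Real.exp (-u)))

/-- The kernel `1 / (2 sinh u)`, as the sum of the geometric series `∑ exp (-(2 m + 1) u)`. -/
noncomputable def halfCsch (u : ℝ) : ℝ := Real.exp (-u) / (1 - Real.exp (-u) ^ 2)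

theorem one_sub_exp_neg_pos {u : ℝ} (hu : 0 < u) : 0 < 1 - Real.exp (-u) := by
  have : Real.exp (-u) < 1 := Real.exp_zero ▸ Real.exp_lt_exp.2 (neg_lt_zero.2 hu)
  linarith

theorem halfCsch_pos {u : ℝ} (hu : 0 < u) : 0 < halfCsch u := by
  have h1 := one_sub_exp_neg_pos hu
  have h2 := Real.exp_pos (-u)
  exact div_pos h2 (by nlinarith)

theorem logCothHalf_pos {u : ℝ} (hu : 0 < u) : 0 < logCothHalf u := by
  have h1 := one_sub_exp_neg_pos hu
  have h2 := Real.exp_pos (-u)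
  exact Real.log_pos ((one_lt_div h1).2 (by linarith))

/-- In the variable `q = exp(-u)` the map is the Möbius involution `q ↦ (1 - q) / (1 + q)`. -/
theorem logCothHalf_logCothHalf {u : ℝ} (hu : 0 < u) : logCothHalf (logCothHalf u) = u := by
  have h1 := one_sub_exp_neg_pos hu
  have h2 := Real.exp_pos (-u)
  have h3 : Real.exp (-logCothHalf u) = (1 - Real.exp (-u)) / (1 + Real.exp (-u)) := by
    rw [Real.exp_neg, logCothHalf, Real.exp_log (by positivity), inv_div]
  have h4 : (1 + Real.exp (-logCothHalf u)) / (1 - Real.exp (-logCothHalf u)) = Real.exp u := by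
    have h5 : Real.exp u = (Real.exp (-u))⁻¹ := by rw [Real.exp_neg, inv_inv]
    rw [h3, h5]
    field_simp
    ring
  rw [logCothHalf, h4, Real.log_exp]

theorem image_logCothHalf : logCothHalf '' Ioi 0 = Ioi 0 :=
  Subset.antisymm (image_subset_iff.2 fun _ hu => logCothHalf_pos hu)
    fun u hu => ⟨logCothHalf u, logCothHalf_pos hu, logCothHalf_logCothHalf hu⟩

theorem injOn_logCothHalf : InjOn logCothHalf (Ioi 0) := fun u hu v hv h => by
  rw [← logCothHalf_logCothHalf hu, h, logCothHalf_logCothHalf hv]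

theorem hasDerivAt_logCothHalf {u : ℝ} (hu : 0 < u) :
    HasDerivAt logCothHalf (-(2 * halfCsch u)) u := by
  have h1 := one_sub_exp_neg_pos hu
  have h2 := Real.exp_pos (-u)
  have he : HasDerivAt (fun u : ℝ => Real.exp (-u)) (-Real.exp (-u)) u := by
    simpa using (hasDerivAt_neg u).exp
  have h := (((he.const_add 1).div (he.const_sub 1) h1.ne').log (by
    simp only [Pi.div_apply]; positivity))
  refine h.congr_deriv ?_
  have h3 : (1 : ℝ) - Real.exp (-u) ^ 2 ≠ 0 := by nlinarith
  simp only [Pi.div_apply, halfCsch]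
  field_simp
  ring

theorem tendsto_logCothHalf : Tendsto logCothHalf atTop (𝓝 0) := by
  have he : Tendsto (fun u : ℝ => Real.exp (-u)) atTop (𝓝 0) :=
    Real.tendsto_exp_atBot.comp tendsto_neg_atTop_atBot
  have h := ((he.const_add 1).div (he.const_sub 1) (by norm_num)).log (by norm_num)
  simpa [← logCothHalf.eq_1] using h

theorem lintegral_logCothHalf_pow (k : ℕ) {u : ℝ} (hu : 0 < u) :
    ∫⁻ v in Ioi u, ENNReal.ofReal (halfCsch v * ((logCothHalf v / 2) ^ k / k.factorial)) =
      ENNReal.ofReal ((logCothHalf u / 2) ^ (k + 1) / (k + 1).factorial) := by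
  have hd : ∀ x ∈ Ici u, HasDerivAt
      (fun v => (logCothHalf v / 2) ^ (k + 1) / ((k + 1).factorial : ℝ))
      (-(halfCsch x * ((logCothHalf x / 2) ^ k / k.factorial))) x := fun x hx => by
    have hx0 : 0 < x := hu.trans_le hx
    refine ((((hasDerivAt_logCothHalf hx0).div_const 2).pow (k + 1)).div_const _).congr_deriv ?_
    rw [Nat.factorial_succ]
    push_cast
    field_simp
  have hn : ∀ x ∈ Ioi u, 0 ≤ halfCsch x * ((logCothHalf x / 2) ^ k / k.factorial) :=
    fun x hx => by
      have h1 := halfCsch_pos (hu.trans hx)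
      have h2 := logCothHalf_pos (hu.trans hx)
      positivity
  have ht : Tendsto (fun v => (logCothHalf v / 2) ^ (k + 1) / ((k + 1).factorial : ℝ)) atTop
      (𝓝 0) := by
    simpa using ((tendsto_logCothHalf.div_const 2).pow (k + 1)).div_const ((k + 1).factorial : ℝ)
  have hI := integrableOn_Ioi_deriv_of_nonpos' hd (fun x hx => neg_nonpos.2 (hn x hx)) ht
  have hV := integral_Ioi_of_hasDerivAt_of_nonpos' hd (fun x hx => neg_nonpos.2 (hn x hx)) ht
  rw [← ofReal_integral_eq_lintegral_ofReal (by simpa [IntegrableOn] using hI.neg)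
    ((ae_restrict_iff' measurableSet_Ioi).2 (Eventually.of_forall hn))]
  rw [integral_neg] at hV
  congr 1
  linarith

/-! ### Exponential and Gamma integrals -/

theorem lintegral_exp_neg_mul {m : ℝ} (hm : 0 < m) (u : ℝ) :
    ∫⁻ v in Ioi u, ENNReal.ofReal (m * Real.exp (-(m * v))) =
      ENNReal.ofReal (Real.exp (-(m * u))) := by
  have hI := (integrableOn_exp_mul_Ioi (neg_lt_zero.2 hm) u).const_mul m
  have hV := integral_exp_mul_Ioi (neg_lt_zero.2 hm) u
  simp only [neg_mul] at hI hV
  rw [← ofReal_integral_eq_lintegral_ofReal hI (Eventually.of_forall fun _ => by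
    simp only [Pi.zero_apply]; positivity), integral_const_mul, hV]
  congr 1
  field_simp

theorem lintegral_exp_neg_mul_pow {m : ℝ} (hm : 0 < m) (a : ℕ) :
    ∫⁻ v in Ioi 0, ENNReal.ofReal (Real.exp (-(m * v)) * (v ^ a / a.factorial)) =
      ENNReal.ofReal (m ^ (a + 1))⁻¹ := by
  have hI := integrableOn_rpow_mul_exp_neg_mul_rpow (p := 1) (s := a) (b := m)
    (by have : (0 : ℝ) ≤ a := by positivity
        linarith) one_pos hm
  have hV := Real.integral_rpow_mul_exp_neg_mul_Ioi (a := a + 1) (r := m) (by positivity) hm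
  simp only [neg_mul, Real.rpow_one, Real.rpow_natCast, add_sub_cancel_right] at hI hV
  have hI' : IntegrableOn (fun v => Real.exp (-(m * v)) * (v ^ a / a.factorial)) (Ioi 0) :=
    (hI.div_const (a.factorial : ℝ)).congr (Eventually.of_forall fun v => by
      simp only; ring)
  rw [← ofReal_integral_eq_lintegral_ofReal hI' ((ae_restrict_iff' measurableSet_Ioi).2
    (Eventually.of_forall fun v hv => by
      have : (0 : ℝ) < v := hv
      simp only [Pi.zero_apply]; positivity))]
  have h : ∀ v : ℝ, Real.exp (-(m * v)) * (v ^ a / a.factorial) =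
      v ^ a * Real.exp (-(m * v)) / a.factorial := fun v => by ring
  simp only [h]
  rw [integral_div, hV, Real.Gamma_nat_eq_factorial]
  congr 1
  have h1 : (1 / m) ^ ((a : ℝ) + 1) = (1 / m) ^ (a + 1) := by
    rw [← Real.rpow_natCast]; push_cast; rfl
  rw [h1, one_div, inv_pow]
  have := Nat.factorial_pos a
  field_simp

/-! ### The generating function in closed form -/

/-- The generating function `∑ exp (-n_k u) / (n₁ ⋯ n_k)` over mixed tuples of length `k`. -/
noncomputable def mixedGenFun (k : ℕ) (u : ℝ) : ENNReal :=
  ∑' n : mixedTuples k, ENNReal.ofReal (invProd n.1 * Real.exp (-(lastEntry n.1 * u)))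

theorem tsum_halfCsch {u : ℝ} (hu : 0 < u) :
    ∑' m : ℕ, ENNReal.ofReal (Real.exp (-u) * (Real.exp (-u) ^ 2) ^ m) =
      ENNReal.ofReal (halfCsch u) := by
  have h1 := one_sub_exp_neg_pos hu
  have h2 := Real.exp_pos (-u)
  have h3 : Real.exp (-u) ^ 2 < 1 := by nlinarith
  have hs := (hasSum_geometric_of_lt_one (sq_nonneg (Real.exp (-u))) h3).mul_left (Real.exp (-u))
  rw [← ENNReal.ofReal_tsum_of_nonneg (fun m => by positivity) hs.summable, hs.tsum_eq]
  rfl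

/-- This is the differential equation for `G_{k+1}`: the left side is its negated termwise
derivative, and the sum over the last gap is geometric. -/
theorem tsum_lastEntry_mul_exp (k : ℕ) {u : ℝ} (hu : 0 < u) :
    ∑' n : mixedTuples (k + 1), ENNReal.ofReal
      (invProd n.1 * (lastEntry n.1 * Real.exp (-(lastEntry n.1 * u)))) =
      ENNReal.ofReal (halfCsch u) * mixedGenFun k u := by
  rw [← (mixedTuplesSnoc k).tsum_eq, mixedGenFun, ← tsum_halfCsch hu, mul_comm,
    ← ENNReal.tsum_mul_right]
  rw [ENNReal.tsum_prod']
  refine tsum_congr fun n => ?_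
  rw [← ENNReal.tsum_mul_left]
  refine tsum_congr fun m => ?_
  rw [← ENNReal.ofReal_mul (mul_nonneg (invProd_nonneg _) (Real.exp_pos _).le),
    invProd_mixedTuplesSnoc, lastEntry_mixedTuplesSnoc]
  have h : Real.exp (-(((lastEntry n.1 + 1 + 2 * m : ℕ) : ℝ) * u)) =
      Real.exp (-(lastEntry n.1 * u)) * (Real.exp (-u) * (Real.exp (-u) ^ 2) ^ m) := by
    rw [← pow_mul, ← Real.exp_nat_mul, ← Real.exp_add, ← Real.exp_add]
    congr 1
    push_cast
    ring
  have h0 : (((lastEntry n.1 + 1 + 2 * m : ℕ) : ℝ)) ≠ 0 := by positivity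
  rw [h]
  congr 1
  field_simp

theorem mixedGenFun_succ (k : ℕ) (u : ℝ) (hu : 0 < u) :
    mixedGenFun (k + 1) u = ∫⁻ v in Ioi u, ENNReal.ofReal (halfCsch v) * mixedGenFun k v := by
  rw [← setLIntegral_congr_fun measurableSet_Ioi
    (fun v hv => tsum_lastEntry_mul_exp k (hu.trans hv)), lintegral_tsum]
  · refine tsum_congr fun n => ?_
    simp only [ENNReal.ofReal_mul (invProd_nonneg n.1)]
    rw [lintegral_const_mul' _ _ ENNReal.ofReal_ne_top,
      lintegral_exp_neg_mul (by exact_mod_cast lastEntry_pos n)]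
  · intro n
    fun_prop

theorem mixedGenFun_eq (k : ℕ) {u : ℝ} (hu : 0 < u) :
    mixedGenFun k u = ENNReal.ofReal ((logCothHalf u / 2) ^ k / k.factorial) := by
  induction k generalizing u with
  | zero =>
    have : Unique (mixedTuples 0) :=
      ⟨⟨⟨Fin.elim0, fun i => i.elim0, fun i => i.elim0⟩⟩, fun _ => Subsingleton.elim _ _⟩
    simp [mixedGenFun, invProd, lastEntry]
  | succ k ih =>
    rw [mixedGenFun_succ k u hu, ← lintegral_logCothHalf_pow k hu]
    refine setLIntegral_congr_fun measurableSet_Ioi fun v hv => ?_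
    rw [ih (hu.trans hv), ENNReal.ofReal_mul (halfCsch_pos (hu.trans hv)).le]

/-! ### Integral representations and duality -/

theorem tsum_eq_lintegral_pow (k a : ℕ) :
    ∑' n : mixedTuples (k + 1), ENNReal.ofReal (invProd n.1 * ((lastEntry n.1 : ℝ) ^ (a + 1))⁻¹) =
      ∫⁻ u in Ioi 0, ENNReal.ofReal ((logCothHalf u / 2) ^ (k + 1) / (k + 1).factorial) *
        ENNReal.ofReal (u ^ a / a.factorial) := by
  rw [← setLIntegral_congr_fun measurableSet_Ioi
    (fun u hu => congrArg (· * ENNReal.ofReal (u ^ a / a.factorial)) (mixedGenFun_eq (k + 1) hu))]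
  simp only [mixedGenFun, ← ENNReal.tsum_mul_right]
  rw [lintegral_tsum (fun n => by fun_prop)]
  refine tsum_congr fun n => ?_
  have hw := invProd_nonneg n.1
  have hn : (0 : ℝ) < lastEntry n.1 := by exact_mod_cast lastEntry_pos n
  rw [ENNReal.ofReal_mul hw, ← lintegral_exp_neg_mul_pow hn,
    ← lintegral_const_mul' _ _ ENNReal.ofReal_ne_top]
  refine lintegral_congr fun u => ?_
  rw [ENNReal.ofReal_mul hw, ENNReal.ofReal_mul (Real.exp_pos _).le, mul_assoc]

theorem tsum_eq_lintegral_halfCsch (k a : ℕ) :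
    ∑' n : mixedTuples (k + 1), ENNReal.ofReal (invProd n.1 * ((lastEntry n.1 : ℝ) ^ (a + 1))⁻¹) =
      ∫⁻ u in Ioi 0, ENNReal.ofReal (halfCsch u) *
        ENNReal.ofReal ((logCothHalf u / 2) ^ k / k.factorial) *
          ENNReal.ofReal (u ^ (a + 1) / (a + 1).factorial) := by
  rw [← setLIntegral_congr_fun measurableSet_Ioi
    (fun u hu => congrArg (fun x => ENNReal.ofReal (halfCsch u) * x *
      ENNReal.ofReal (u ^ (a + 1) / (a + 1).factorial)) (mixedGenFun_eq k hu))]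
  rw [← setLIntegral_congr_fun measurableSet_Ioi
    (fun u hu => congrArg (· * ENNReal.ofReal (u ^ (a + 1) / (a + 1).factorial))
      (tsum_lastEntry_mul_exp k hu))]
  simp only [← ENNReal.tsum_mul_right]
  rw [lintegral_tsum (fun n => by fun_prop)]
  refine tsum_congr fun n => ?_
  have hw := invProd_nonneg n.1
  have hn : (0 : ℝ) < lastEntry n.1 := by exact_mod_cast lastEntry_pos n
  -- The extra factor `n_{k+1}` comes from the derivative, so the Gamma integral must supply one
  -- more power.
  have h : invProd n.1 * ((lastEntry n.1 : ℝ) ^ (a + 1))⁻¹ =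
      invProd n.1 * lastEntry n.1 * ((lastEntry n.1 : ℝ) ^ (a + 1 + 1))⁻¹ := by
    rw [pow_succ _ (a + 1)]
    field_simp
  have hw' : 0 ≤ invProd n.1 * (lastEntry n.1 : ℝ) := mul_nonneg hw hn.le
  rw [h, ENNReal.ofReal_mul hw', ← lintegral_exp_neg_mul_pow hn,
    ← lintegral_const_mul' _ _ ENNReal.ofReal_ne_top]
  refine lintegral_congr fun u => ?_
  rw [← mul_assoc (invProd n.1), ENNReal.ofReal_mul hw', ENNReal.ofReal_mul (Real.exp_pos _).le,
    mul_assoc]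

theorem tsum_duality (n r : ℕ) :
    2 ^ n * ∑' t : mixedTuples (n + 1), ENNReal.ofReal
      (invProd t.1 * ((lastEntry t.1 : ℝ) ^ (r + 1))⁻¹) =
    2 ^ r * ∑' t : mixedTuples (r + 1), ENNReal.ofReal
      (invProd t.1 * ((lastEntry t.1 : ℝ) ^ (n + 1))⁻¹) := by
  rw [tsum_eq_lintegral_halfCsch r n, tsum_eq_lintegral_pow n r]
  have h := lintegral_image_eq_lintegral_abs_deriv_mul measurableSet_Ioi
    (fun u hu => (hasDerivAt_logCothHalf hu).hasDerivWithinAt) injOn_logCothHalf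
    (fun u => ENNReal.ofReal ((logCothHalf u / 2) ^ (n + 1) / (n + 1).factorial) *
        ENNReal.ofReal (u ^ r / r.factorial))
  rw [image_logCothHalf] at h
  rw [h, ← lintegral_const_mul' _ _ (by finiteness), ← lintegral_const_mul' _ _ (by finiteness)]
  refine setLIntegral_congr_fun measurableSet_Ioi fun u hu => ?_
  have h0 : (0 : ℝ) < u := hu
  have h1 := halfCsch_pos h0
  have h2 := logCothHalf_pos h0
  have h3 : ∀ k : ℕ, (2 : ENNReal) ^ k = ENNReal.ofReal (2 ^ k) := fun k => by
    rw [ENNReal.ofReal_pow (by norm_num)]; simp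
  simp only [logCothHalf_logCothHalf h0]
  rw [abs_neg, abs_of_pos (by positivity), h3, h3, ← ENNReal.ofReal_mul (by positivity),
    ← ENNReal.ofReal_mul (by positivity), ← ENNReal.ofReal_mul (by positivity),
    ← ENNReal.ofReal_mul (by positivity), ← ENNReal.ofReal_mul (by positivity),
    ← ENNReal.ofReal_mul (by positivity)]
  congr 1
  simp only [div_pow, pow_succ]
  field_simp

theorem summable_mixedTerm_cons_ones (a n : ℕ) :
    Summable (mixedTerm ((a + 2) :: List.replicate n 1)) :=
  (summable_invProd_mul_lastEntry (List.replicate n 1).length a).congr fun t =>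
    (mixedTerm_cons_ones (fun _ => List.eq_of_mem_replicate) (a + 1) t).symm

theorem ofReal_multipleMixedValue_cons_ones (a n : ℕ) :
    ENNReal.ofReal (multipleMixedValue ((a + 2) :: List.replicate n 1)) =
      ∑' t : mixedTuples (n + 1), ENNReal.ofReal
        (invProd t.1 * ((lastEntry t.1 : ℝ) ^ (a + 1))⁻¹) := by
  have h : multipleMixedValue ((a + 2) :: List.replicate n 1) =
      ∑' t : mixedTuples ((List.replicate n 1).length + 1),
        invProd t.1 * ((lastEntry t.1 : ℝ) ^ (a + 1))⁻¹ :=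
    tsum_congr fun t => mixedTerm_cons_ones (fun _ => List.eq_of_mem_replicate) (a + 1) t
  rw [h, List.length_replicate]
  exact ENNReal.ofReal_tsum_of_nonneg (fun t => mul_nonneg (invProd_nonneg _) (by positivity))
    (summable_invProd_mul_lastEntry n a)

theorem multipleMixedValue_nonneg (s : List ℕ) : 0 ≤ multipleMixedValue s :=
  tsum_nonneg fun _ => div_nonneg zero_le_one (Finset.prod_nonneg fun _ _ => by positivity)

theorem theorem6 (n r : ℕ) :
    Summable (mixedTerm ((r + 2) :: List.replicate n 1)) ∧
    Summable (mixedTerm ((n + 2) :: List.replicate r 1)) ∧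
    2 ^ n * multipleMixedValue ((r + 2) :: List.replicate n 1) =
      2 ^ r * multipleMixedValue ((n + 2) :: List.replicate r 1) := by
  refine ⟨summable_mixedTerm_cons_ones r n, summable_mixedTerm_cons_ones n r, ?_⟩
  have h := tsum_duality n r
  rw [← ofReal_multipleMixedValue_cons_ones, ← ofReal_multipleMixedValue_cons_ones] at h
  have h' := congrArg ENNReal.toReal h
  simpa [ENNReal.toReal_ofReal (multipleMixedValue_nonneg _)] using h'
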